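/- Let $H$ be a complex Hilbert space, let $1<p\le 2$, and let $a=(a_1,a_2,\dots)$ be a sequence of positive semi-definite bounded operators on $H$ such that the infinite sum $\sum_{n=1}^\infty a_n^p$ converges to a bounded operator in the weak operator topology and $\left(\sum_{n=1}^\infty a_n^p\right)^{1/p}$ is of trace class. For such sequences put \[ \Phi_p(a)=\operatorname{Tr}\left[\left(\sum_{n=1}^\infty a_n^p\right)^{1/p}\right]. \] Let $h(a)$ denote the sequence of arithmetic means, $h(a)_n=\frac1n\sum_{k=1}^n a_k$ for $n\ge 1$. Then $h(a)$ satisfies the same conditions, that is, $h(a)$ consists of positive semi-definite operators, $\sum_{n=1}^\infty h(a)_n^p$ converges to a bounded operator in the weak operator topology and $\left(\sum_{n=1}^\infty h(a)_n^p\right)^{1/p}$ is of trace class, and \[ \Phi_p(h(a))\le\frac{p}{p-1}\,\Phi_p(a). \] -/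

import Mathlib

open scoped InnerProductSpace ENNReal

namespace OperatorHardy

universe u

variable {H : Type u} [NormedAddCommGroup H] [InnerProductSpace ℂ H] [CompleteSpace H]

/-- The Hardy (arithmetic averaging) operator on sequences of operators. Sequences are indexed
from `0`, so the entry with index `n` is the mean of the first `n + 1` terms. -/
noncomputable def hardy (a : ℕ → H →L[ℂ] H) (n : ℕ) : H →L[ℂ] H :=
  ((n : ℝ) + 1)⁻¹ • ∑ k ∈ Finset.range (n + 1), a k

/-- The infinite sum `∑ₙ aₙ ^ p` defines a bounded operator: it converges in `B(H)` for the weak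
operator topology. (For sums of positive operators this is the same as convergence in the strong
operator topology and as boundedness of the partial sums.) -/
def SummablePow (p : ℝ) (a : ℕ → H →L[ℂ] H) : Prop :=
  Summable fun n => ContinuousLinearMapWOT.ofCLM (σ := RingHom.id ℂ) (a n ^ p)

/-- The operator `∑ₙ aₙ ^ p` (meaningful when `SummablePow p a` holds). -/
noncomputable def sumPow (p : ℝ) (a : ℕ → H →L[ℂ] H) : H →L[ℂ] H :=
  ContinuousLinearMapWOT.toCLM (∑' n, ContinuousLinearMapWOT.ofCLM (σ := RingHom.id ℂ) (a n ^ p))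

/-- A bounded operator `T` is of trace class if `∑ᵢ ⟪eᵢ, |T| eᵢ⟫ < ∞` for the orthonormal
bases `(eᵢ)` of `H`. -/
def IsTraceClass (T : H →L[ℂ] H) : Prop :=
  ∀ (ι : Type u) (b : HilbertBasis ι ℂ H), Summable fun i => ⟪b i, CFC.abs T (b i)⟫_ℂ

/-- The trace `∑ᵢ ⟪eᵢ, T eᵢ⟫`, computed in some orthonormal basis of `H`. -/
noncomputable def trace (T : H →L[ℂ] H) : ℂ :=
  ∑' i, ⟪(exists_hilbertBasis ℂ H).choose_spec.choose i,
    T ((exists_hilbertBasis ℂ H).choose_spec.choose i)⟫_ℂ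

theorem ofReal_norm_sq_eq_tsum {ι : Type*} (b : HilbertBasis ι ℂ H) (x : H) :
    ENNReal.ofReal (‖x‖ ^ 2) = ∑' i, ENNReal.ofReal (‖⟪b i, x⟫_ℂ‖ ^ 2) := by
  have h := b.hasSum_inner_mul_inner x x
  have h2 : HasSum (fun i => ‖⟪b i, x⟫_ℂ‖ ^ 2) (‖x‖ ^ 2) := by
    have h3 := Complex.hasSum_re h
    have e : ∀ i, (⟪x, b i⟫_ℂ * ⟪b i, x⟫_ℂ).re = ‖⟪b i, x⟫_ℂ‖ ^ 2 := by
      intro i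
      rw [← inner_conj_symm x (b i), mul_comm, Complex.mul_conj, Complex.normSq_eq_norm_sq]
      norm_cast
    have e2 : (⟪x, x⟫_ℂ).re = ‖x‖ ^ 2 := by
      rw [inner_self_eq_norm_sq_to_K]; norm_cast
    simpa only [e, e2] using h3
  rw [← h2.tsum_eq, ENNReal.ofReal_tsum_of_nonneg (fun i => by positivity) h2.summable]

theorem tsum_norm_sq_eq {ι κ : Type*} (b : HilbertBasis ι ℂ H) (c : HilbertBasis κ ℂ H)
    {S : H →L[ℂ] H} (hS : IsSelfAdjoint S) :
    ∑' i, ENNReal.ofReal (‖S (b i)‖ ^ 2) = ∑' j, ENNReal.ofReal (‖S (c j)‖ ^ 2) := by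
  simp_rw [ofReal_norm_sq_eq_tsum c (S (b _)), ofReal_norm_sq_eq_tsum b (S (c _))]
  rw [ENNReal.tsum_comm]
  refine tsum_congr fun j => tsum_congr fun i => ?_
  have : ⟪c j, S (b i)⟫_ℂ = ⟪S (c j), b i⟫_ℂ := by
    rw [← ContinuousLinearMap.adjoint_inner_left, ← ContinuousLinearMap.star_eq_adjoint,
      hS.star_eq]
  rw [this, norm_inner_symm]

/-- For a positive semi-definite operator the trace can be computed in any orthonormal basis. -/
theorem trace_eq_tsum {T : H →L[ℂ] H} (hT : 0 ≤ T) {ι : Type*} (c : HilbertBasis ι ℂ H) :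
    trace T = ∑' i, ⟪c i, T (c i)⟫_ℂ := by
  have hS : IsSelfAdjoint (CFC.sqrt T) := (CFC.sqrt_nonneg T).isSelfAdjoint
  have key : ∀ x : H, ⟪x, T x⟫_ℂ = ((ENNReal.ofReal (‖CFC.sqrt T x‖ ^ 2)).toReal : ℂ) := by
    intro x
    rw [ENNReal.toReal_ofReal (by positivity)]
    conv_lhs => rw [← CFC.sqrt_mul_sqrt_self T hT]
    rw [mul_apply_eq_comp, ← ContinuousLinearMap.adjoint_inner_left,
      ← ContinuousLinearMap.star_eq_adjoint, hS.star_eq, inner_self_eq_norm_sq_to_K]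
    norm_cast
  unfold trace
  simp_rw [key]
  rw [← Complex.ofReal_tsum, ← Complex.ofReal_tsum,
    ← ENNReal.tsum_toReal_eq (fun _ => ENNReal.ofReal_ne_top),
    ← ENNReal.tsum_toReal_eq (fun _ => ENNReal.ofReal_ne_top), tsum_norm_sq_eq _ c hS]

/-- The domain of `Φ_p`: sequences of positive semi-definite operators such that
`(∑ₙ aₙ ^ p) ^ (1 / p)` defines a bounded trace class operator. -/
structure InDomain (p : ℝ) (a : ℕ → H →L[ℂ] H) : Prop where
  nonneg : ∀ n, 0 ≤ a n
  summable : SummablePow p a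
  traceClass : IsTraceClass (sumPow p a ^ (1 / p))

/-- The functional `Φ_p(a) = Tr (∑ₙ aₙ ^ p) ^ (1 / p)`. The trace of a positive operator is a
non-negative real number; `Φ_p` is taken to be real-valued. -/
noncomputable def Phi (p : ℝ) (a : ℕ → H →L[ℂ] H) : ℝ :=
  (trace (sumPow p a ^ (1 / p))).re

end OperatorHardy

/-!
# Hardy's inequality for sequences of positive operators

For `1 < p ≤ 2` the inequality already holds in the Loewner order:
`∑ h(a)ₙ ^ p ≤ (p / (p - 1)) ^ p • ∑ aₙ ^ p` (`OperatorHardy.summablePow_hardy`). Taking the root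
`1 / p`, which is operator monotone, and then the trace, which is monotone on positive operators
(`OperatorHardy.isTraceClass_of_le_smul`), gives the statement about `Φ_p`. No convexity of the
trace functional `Φ_p` is needed.

The operator inequality is a weighted Jensen argument. The function `x ↦ x ^ p` is operator convex
for `1 ≤ p ≤ 2` (`CFC.convexOn_rpow`). Put `c = 1 - 1 / p` and use the weights
`w k = (k + 1) ^ c - k ^ c`, for which `w 0 + ⋯ + w n = (n + 1) ^ c`. Writing the arithmetic mean of
`a 0, …, a n` as a convex combination with weights `w k / (n + 1) ^ c` of multiples of the `a k`,
Jensen's inequality gives (`OperatorHardy.hardy_rpow_le`)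
`h(a)ₙ ^ p ≤ ∑ k ≤ n, (n + 1) ^ (-c - 1) * w k ^ (1 - p) • a k ^ p`.
It remains to sum over `n ≥ k`. The midpoint inequality for convex powers
(`Real.two_mul_mul_rpow_sub_one_le`) bounds `∑ n ≥ k, (n + 1) ^ (-c - 1)` by
`(k + 1 / 2) ^ (-c) / c` and `w k` from below by `c * (k + 1 / 2) ^ (c - 1)`. The powers of
`k + 1 / 2` cancel, and exactly `c ^ (-p) = (p / (p - 1)) ^ p` is left
(`OperatorHardy.sum_Ico_hardyCoeff_le`).

Weak convergence of `∑ h(a)ₙ ^ p` comes from the same bound on the partial sums, since an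
increasing bounded sequence of positive operators converges
(`OperatorHardy.summable_wot_of_sum_le`).
-/

/-! ### Operator convexity of powers with exponent in `[1, 2]` -/

namespace CFC

variable {A : Type*} [CStarAlgebra A] [PartialOrder A] [StarOrderedRing A]

open Set in
/-- The integrand is `x ↦ t ^ (p - 1) * (t⁻¹ * x + t * (t + x)⁻¹ - 1)`, an affine function plus a
positive multiple of a resolvent, and the resolvent is operator convex on positive elements. -/
theorem convexOn_cfc_rpowIntegrand₁₂ {p t : ℝ} (ht : 0 < t) :
    ConvexOn ℝ (Ici (0 : A)) (cfc (Real.rpowIntegrand₁₂ p t)) := by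
  have h₁ : (Ici (0 : A)).EqOn (cfc (Real.rpowIntegrand₁₂ p t))
      (fun x : A => t ^ (p - 1) •
        (t⁻¹ • x + t • Ring.inverse (algebraMap ℝ A t + x) - algebraMap ℝ A 1)) := by
    intro x hx
    have hx : 0 ≤ x := hx
    have hspectrum : ∀ r ∈ spectrum ℝ x, t + r ≠ 0 := by grind
    have hg : ContinuousOn (fun z : ℝ => (t + z)⁻¹) (spectrum ℝ x) := by
      fun_prop (disch := grind -abstractProof)
    have e₁ : cfc (fun z : ℝ => t⁻¹ * z) x = t⁻¹ • x := cfc_const_mul_id t⁻¹ x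
    have e₂ : cfc (fun z : ℝ => t * (t + z)⁻¹) x =
        t • Ring.inverse (algebraMap ℝ A t + x) := by
      rw [cfc_const_mul t _ x hg, cfc_inv _ _ hspectrum .., cfc_const_add .., cfc_id' ..]
    have hg' : ContinuousOn (fun z : ℝ => t * (t + z)⁻¹) (spectrum ℝ x) := hg.const_mul t
    have hl : ContinuousOn (fun z : ℝ => t⁻¹ * z) (spectrum ℝ x) := by fun_prop
    have e₃ : cfc (fun z : ℝ => t⁻¹ * z + t * (t + z)⁻¹ - 1) x =
        t⁻¹ • x + t • Ring.inverse (algebraMap ℝ A t + x) - algebraMap ℝ A 1 := by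
      rw [cfc_sub (fun z : ℝ => t⁻¹ * z + t * (t + z)⁻¹) (fun _ => 1) x (hl.add hg')
        continuousOn_const, cfc_add x (fun z : ℝ => t⁻¹ * z) _ hl hg', e₁, e₂, cfc_const 1 x]
    change cfc (fun z : ℝ => t ^ (p - 1) * (t⁻¹ * z + t * (t + z)⁻¹ - 1)) x = _
    rw [cfc_const_mul _ (fun z : ℝ => t⁻¹ * z + t * (t + z)⁻¹ - 1) x
      ((hl.add hg').sub continuousOn_const), e₃]
  refine ConvexOn.congr ?_ h₁.symm
  refine ConvexOn.smul (by positivity) (ConvexOn.sub (ConvexOn.add ?_ ?_)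
    (concaveOn_const _ (convex_Ici 0)))
  · exact (LinearMap.convexOn (t⁻¹ • LinearMap.id : A →ₗ[ℝ] A) (convex_Ici 0))
  · exact ConvexOn.smul ht.le <| CStarAlgebra.convexOn_ringInverse_algebraMap_add ht

open Set in
theorem convexOn_mul_self : ConvexOn ℝ (Ici (0 : A)) (fun a : A => a * a) := by
  refine ⟨convex_Ici 0, fun a ha b hb s t hs ht hst => ?_⟩
  have hab : IsSelfAdjoint (a - b) :=
    (IsSelfAdjoint.of_nonneg ha).sub (IsSelfAdjoint.of_nonneg hb)
  have h : 0 ≤ (s * t) • ((a - b) * (a - b)) :=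
    smul_nonneg (mul_nonneg hs ht) hab.mul_self_nonneg
  -- `s a² + t b² - (s a + t b)² = s t (a - b)²` when `s + t = 1`
  rw [← sub_nonneg]
  convert h using 1
  obtain rfl : t = 1 - s := by linarith
  simp only [add_mul, mul_add, sub_mul, mul_sub, smul_mul_assoc, mul_smul_comm]
  module

open Set MeasureTheory in
/-- `a ↦ a ^ p` is operator convex for `p ∈ [1, 2]`. In the open interval it is an integral of the
operator convex functions `rpowIntegrand₁₂ p t`. -/
theorem convexOn_rpow {p : ℝ} (hp : p ∈ Icc 1 2) :
    ConvexOn ℝ (Ici (0 : A)) (fun a : A => a ^ p) := by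
  obtain rfl | h1 := hp.1.eq_or_lt
  · exact (convexOn_id (convex_Ici _)).congr fun a ha => (CFC.rpow_one a ha).symm
  obtain rfl | h2 := hp.2.eq_or_lt
  · refine convexOn_mul_self.congr fun a ha => ?_
    have := CFC.rpow_natCast a 2 ha
    simpa [pow_two] using this.symm
  lift p to NNReal using by linarith
  have hp' : p ∈ Ioo 1 2 := ⟨by exact_mod_cast h1, by exact_mod_cast h2⟩
  simp_rw [← CFC.nnrpow_eq_rpow (zero_lt_one.trans hp'.1)]
  obtain ⟨μ, hμ⟩ := CFC.exists_measure_nnrpow_eq_integral_cfcₙ_rpowIntegrand₁₂ A hp'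
  refine ConvexOn.congr ?_ fun a ha => ((hμ a ha).2).symm
  refine integral_convexOn_of_integrand_ae (convex_Ici _) ?_ fun a ha => (hμ a ha).1
  filter_upwards [ae_restrict_mem measurableSet_Ioi] with t (ht : 0 < t)
  refine (convexOn_cfc_rpowIntegrand₁₂ (p := p) ht).congr fun a ha => ?_
  have ha : 0 ≤ a := ha
  refine (cfcₙ_eq_cfc ?_ (Real.rpowIntegrand₁₂_zero ht)).symm
  exact (Real.continuousOn_rpowIntegrand₁₂_uncurry h1 (quasispectrum ℝ a)
    (by grind)).uncurry_left t ht

theorem smul_rpow {p r : ℝ} (hp : 0 ≤ p) (hr : 0 ≤ r) {a : A} (ha : 0 ≤ a) :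
    (r • a) ^ p = r ^ p • a ^ p := by
  lift r to NNReal using hr
  have hc : Continuous fun x : NNReal => x ^ p := NNReal.continuous_rpow_const hp
  rw [← NNReal.coe_rpow, ← NNReal.smul_def, ← NNReal.smul_def, CFC.rpow_def, CFC.rpow_def,
    ← cfc_comp_smul r (fun x : NNReal => x ^ p) a hc.continuousOn ha,
    ← cfc_smul _ _ a hc.continuousOn]
  refine cfc_congr fun x _ => ?_
  simp [NNReal.mul_rpow]

end CFC

/-! ### The scalar weights -/

namespace Real

/-- The midpoint inequality `2 s x ^ (d - 1) ≤ ∫ u ^ (d - 1)` over `[x - s, x + s]` for the convex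
function `u ↦ u ^ (d - 1)`, with the integral evaluated. For `d < 0` the integral has to stay away
from the singularity at `0`. -/
theorem two_mul_mul_rpow_sub_one_le {d x s : ℝ} (hd : d ≠ 0) (hd1 : d ≤ 1)
    (hs : 0 ≤ s) (hsx : s ≤ x) (h : 0 ≤ d ∨ s < x) :
    2 * s * x ^ (d - 1) ≤ ((x + s) ^ d - (x - s) ^ d) / d := by
  let φ : ℝ → ℝ := fun u => ((x + u) ^ d - (x - u) ^ d) / d - 2 * u * x ^ (d - 1)
  have hder : ∀ u ∈ Set.Ioo 0 s,
      HasDerivAt φ ((x + u) ^ (d - 1) + (x - u) ^ (d - 1) - 2 * x ^ (d - 1)) u := by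
    intro u hu
    have h1 : HasDerivAt (fun u => (x + u) ^ d) (1 * d * (x + u) ^ (d - 1)) u :=
      ((hasDerivAt_id u).const_add x).rpow_const (Or.inl (by simp; linarith [hu.1, hu.2]))
    have h2 : HasDerivAt (fun u => (x - u) ^ d) (-1 * d * (x - u) ^ (d - 1)) u :=
      ((hasDerivAt_id u).const_sub x).rpow_const (Or.inl (by simp; linarith [hu.1, hu.2]))
    have h3 : HasDerivAt (fun u => 2 * u * x ^ (d - 1)) (2 * 1 * x ^ (d - 1)) u :=
      ((hasDerivAt_id u).const_mul 2).mul_const _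
    refine (((h1.sub h2).div_const d).sub h3).congr_deriv ?_
    field_simp
    ring
  have hmono : MonotoneOn φ (Set.Icc 0 s) := by
    refine monotoneOn_of_deriv_nonneg (convex_Icc 0 s) ?_ ?_ ?_
    · refine ContinuousOn.sub (ContinuousOn.div_const (ContinuousOn.sub ?_ ?_) _) (by fun_prop)
      · refine ContinuousOn.rpow_const (by fun_prop) fun u hu => ?_
        rcases h with h | h
        · exact Or.inr h
        · exact Or.inl (by linarith [hu.1])
      · refine ContinuousOn.rpow_const (by fun_prop) fun u hu => ?_
        rcases h with h | h
        · exact Or.inr h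
        · exact Or.inl (by linarith [hu.2])
    · rw [interior_Icc]
      exact fun u hu => (hder u hu).differentiableAt.differentiableWithinAt
    · rw [interior_Icc]
      intro u hu
      rw [(hder u hu).deriv]
      have hp : 0 < x + u := by linarith [hu.1, hu.2]
      have hm : 0 < x - u := by linarith [hu.1, hu.2]
      have hx : 0 < x := by linarith [hu.1, hu.2]
      -- the derivative is nonnegative by the inequality of arithmetic and geometric means,
      -- since `(x + u) (x - u) ≤ x ^ 2` and the exponent `d - 1` is not positive
      have hamgm : x ^ (d - 1) * x ^ (d - 1) ≤ (x + u) ^ (d - 1) * (x - u) ^ (d - 1) := by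
        rw [← mul_rpow hx.le hx.le, ← mul_rpow hp.le hm.le]
        exact rpow_le_rpow_of_nonpos (mul_pos hp hm) (by nlinarith [sq_nonneg u]) (by linarith)
      have h1 := rpow_pos_of_pos hp (d - 1)
      have h2 := rpow_pos_of_pos hm (d - 1)
      have h3 := rpow_pos_of_pos hx (d - 1)
      nlinarith [sq_nonneg ((x + u) ^ (d - 1) - (x - u) ^ (d - 1))]
  have := hmono ⟨le_rfl, hs⟩ ⟨hs, le_rfl⟩ hs
  simpa [φ] using this

end Real

namespace OperatorHardy

/-- The unnormalised Jensen weights `(k + 1) ^ c - k ^ c`. For `c ≠ 0` the first `n + 1` of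
them have the sum `(n + 1) ^ c`. -/
noncomputable def hardyWeight (c : ℝ) (k : ℕ) : ℝ := ((k : ℝ) + 1) ^ c - (k : ℝ) ^ c

theorem sum_hardyWeight {c : ℝ} (hc : c ≠ 0) (n : ℕ) :
    ∑ k ∈ Finset.range n, hardyWeight c k = (n : ℝ) ^ c := by
  have := Finset.sum_range_sub (fun k : ℕ => (k : ℝ) ^ c) n
  simpa [hardyWeight, Real.zero_rpow hc] using this

theorem mul_rpow_le_hardyWeight {c : ℝ} (hc : 0 < c) (hc1 : c ≤ 1) (k : ℕ) :
    c * ((k : ℝ) + 1 / 2) ^ (c - 1) ≤ hardyWeight c k := by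
  have := Real.two_mul_mul_rpow_sub_one_le (x := k + 1 / 2) (s := 1 / 2) hc.ne' hc1
    (by norm_num) (by simp) (Or.inl hc.le)
  rw [le_div_iff₀ hc, add_sub_cancel_right, add_assoc, add_halves] at this
  rw [hardyWeight]
  linarith

theorem hardyWeight_pos {c : ℝ} (hc : 0 < c) (hc1 : c ≤ 1) (k : ℕ) : 0 < hardyWeight c k :=
  lt_of_lt_of_le (by positivity) (mul_rpow_le_hardyWeight hc hc1 k)

theorem sum_Ico_rpow_le {c : ℝ} (hc : 0 < c) (k N : ℕ) :
    ∑ n ∈ Finset.Ico k N, ((n : ℝ) + 1) ^ (-c - 1) ≤ ((k : ℝ) + 1 / 2) ^ (-c) / c := by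
  rcases le_total N k with h | h
  · rw [Finset.Ico_eq_empty_of_le h, Finset.sum_empty]
    positivity
  suffices ∑ n ∈ Finset.Ico k N, ((n : ℝ) + 1) ^ (-c - 1) ≤
      ∑ n ∈ Finset.Ico k N, (((n + 1 : ℕ) + 1 / 2 : ℝ) ^ (-c) / (-c) -
        ((n : ℝ) + 1 / 2) ^ (-c) / (-c)) by
    -- the right-hand side telescopes
    rw [Finset.sum_Ico_sub (fun n : ℕ => ((n : ℝ) + 1 / 2) ^ (-c) / (-c)) h] at this
    refine this.trans ?_
    have : 0 ≤ ((N : ℝ) + 1 / 2) ^ (-c) / c := by positivity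
    rw [div_neg, div_neg]
    linarith
  refine Finset.sum_le_sum fun n _ => ?_
  have hn : (0 : ℝ) ≤ n := n.cast_nonneg
  have := Real.two_mul_mul_rpow_sub_one_le (d := -c) (x := n + 1) (s := 1 / 2) (by linarith)
    (by linarith) (by norm_num) (by linarith) (Or.inr (by linarith))
  have e : (n : ℝ) + 1 - 1 / 2 = n + 1 / 2 := by ring
  rw [← sub_div, Nat.cast_succ, ← e]
  linarith

/-- The coefficient of `a k ^ p` in the Jensen bound for `hardy a n ^ p`, namely
`(n + 1) ^ (-c - 1) * w k ^ (1 - p)` with `c = 1 - 1 / p` and `w = hardyWeight c`. -/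
noncomputable def hardyCoeff (p : ℝ) (n k : ℕ) : ℝ :=
  ((n : ℝ) + 1) ^ (-(1 - 1 / p) - 1) * hardyWeight (1 - 1 / p) k ^ (1 - p)

theorem one_sub_one_div_mem {p : ℝ} (hp : 1 < p) : 0 < 1 - 1 / p ∧ 1 - 1 / p ≤ 1 := by
  have h1 : 1 / p < 1 := by rw [div_lt_one (by linarith)]; exact hp
  have h2 : 0 < 1 / p := by positivity
  constructor <;> linarith

/-- The column sums of the coefficients are at most the optimal Hardy constant: the midpoint bounds
for the power sum and for the weight are both powers of `k + 1 / 2`, and these cancel. -/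
theorem sum_Ico_hardyCoeff_le {p : ℝ} (hp : 1 < p) (k N : ℕ) :
    ∑ n ∈ Finset.Ico k N, hardyCoeff p n k ≤ (p / (p - 1)) ^ p := by
  obtain ⟨hc, hc1⟩ := one_sub_one_div_mem hp
  have hpc : (p / (p - 1)) = (1 - 1 / p)⁻¹ := by
    have : p - 1 ≠ 0 := by linarith
    field_simp
  have hcp : (1 - 1 / p - 1) * (1 - p) = 1 - 1 / p := by field_simp; ring
  simp only [hardyCoeff]
  rw [hpc, ← Finset.sum_mul]
  generalize 1 - 1 / p = c at *
  have hx : (0 : ℝ) < k + 1 / 2 := by positivity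
  calc _ ≤ ((k : ℝ) + 1 / 2) ^ (-c) / c * (c * ((k : ℝ) + 1 / 2) ^ (c - 1)) ^ (1 - p) := by
        gcongr ?_ * ?_
        · exact Real.rpow_nonneg (hardyWeight_pos hc hc1 k).le _
        · exact sum_Ico_rpow_le hc k N
        · exact Real.rpow_le_rpow_of_nonpos (by positivity) (mul_rpow_le_hardyWeight hc hc1 k)
            (by linarith)
    _ = (c⁻¹) ^ p := by
        rw [Real.mul_rpow hc.le (by positivity), ← Real.rpow_mul hx.le, hcp, Real.rpow_neg hx.le,
          Real.inv_rpow hc.le, Real.rpow_sub hc, Real.rpow_one]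
        field_simp

/-! ### Hardy's inequality in the Loewner order -/

section

variable {H : Type*} [NormedAddCommGroup H] [InnerProductSpace ℂ H] [CompleteSpace H]

/-- Jensen's inequality for the operator convex function `x ↦ x ^ p`, applied to the arithmetic mean
written as a convex combination with weights proportional to `hardyWeight (1 - 1 / p)`. -/
theorem hardy_rpow_le {p : ℝ} (hp : 1 < p) (hp2 : p ≤ 2) {a : ℕ → H →L[ℂ] H}
    (ha : ∀ n, 0 ≤ a n) (n : ℕ) :
    hardy a n ^ p ≤ ∑ k ∈ Finset.range (n + 1), hardyCoeff p n k • a k ^ p := by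
  obtain ⟨hc, hc1⟩ := one_sub_one_div_mem hp
  have hcp : (1 - 1 / p - 1) * p = -1 := by field_simp; ring
  unfold hardyCoeff
  generalize 1 - 1 / p = c at *
  have hw := hardyWeight_pos hc hc1
  have hn : (0 : ℝ) < n + 1 := by positivity
  have hW : (0 : ℝ) < ((n : ℝ) + 1) ^ c := by positivity
  set W := ((n : ℝ) + 1) ^ c with hWdef
  -- each `a k` is rescaled so that the weights of the combination have sum `1`
  have hsplit : hardy a n = ∑ k ∈ Finset.range (n + 1),
      (hardyWeight c k / W) • ((W / (n + 1) / hardyWeight c k) • a k) := by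
    rw [hardy, Finset.smul_sum]
    refine Finset.sum_congr rfl fun k _ => ?_
    rw [smul_smul]
    congr 1
    have := (hw k).ne'
    field_simp
  have hcoef (k : ℕ) : 0 ≤ W / (n + 1) / hardyWeight c k := by
    have := hw k
    positivity
  rw [hsplit]
  refine ((CFC.convexOn_rpow (A := H →L[ℂ] H) (p := p) ⟨hp.le, hp2⟩).map_sum_le
    (t := Finset.range (n + 1)) (w := fun k => hardyWeight c k / W)
    (p := fun k => (W / (n + 1) / hardyWeight c k) • a k)
    (fun k _ => (div_pos (hw k) hW).le) ?_ (fun k _ => smul_nonneg (hcoef k) (ha k))).trans_eq ?_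
  · rw [← Finset.sum_div, sum_hardyWeight hc.ne', hWdef, Nat.cast_succ, div_self hW.ne']
  · refine Finset.sum_congr rfl fun k _ => ?_
    rw [CFC.smul_rpow (by linarith) (hcoef k) (ha k), smul_smul]
    congr 1
    have e : W / (n + 1) = ((n : ℝ) + 1) ^ (c - 1) := by
      rw [Real.rpow_sub_one hn.ne']
    rw [e, Real.div_rpow (by positivity) (hw k).le, ← Real.rpow_mul hn.le, hcp,
      Real.rpow_sub (hw k), Real.rpow_one, Real.rpow_sub hn, Real.rpow_neg hn.le c,
      Real.rpow_neg hn.le, Real.rpow_one, ← hWdef]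
    field_simp

/-- Hardy's inequality for partial sums, as an inequality between operators rather than traces. -/
theorem sum_hardy_rpow_le {p : ℝ} (hp : 1 < p) (hp2 : p ≤ 2) {a : ℕ → H →L[ℂ] H}
    (ha : ∀ n, 0 ≤ a n) (N : ℕ) :
    ∑ n ∈ Finset.range N, hardy a n ^ p ≤
      (p / (p - 1)) ^ p • ∑ k ∈ Finset.range N, a k ^ p := by
  calc _ ≤ ∑ n ∈ Finset.range N, ∑ k ∈ Finset.range (n + 1), hardyCoeff p n k • a k ^ p :=
        Finset.sum_le_sum fun n _ => hardy_rpow_le hp hp2 ha n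
    _ = ∑ k ∈ Finset.range N, ∑ n ∈ Finset.Ico k N, hardyCoeff p n k • a k ^ p := by
        refine Finset.sum_comm' fun n k => ?_
        simp only [Finset.mem_range, Finset.mem_Ico]
        omega
    _ ≤ _ := by
        rw [Finset.smul_sum]
        refine Finset.sum_le_sum fun k _ => ?_
        rw [← Finset.sum_smul]
        exact smul_le_smul_of_nonneg_right (sum_Ico_hardyCoeff_le hp k N) CFC.rpow_nonneg

end

/-! ### Weak operator convergence of positive series -/

section

universe u

variable {H : Type u} [NormedAddCommGroup H] [InnerProductSpace ℂ H]

theorem re_inner_apply_nonneg {T : H →L[ℂ] H} (hT : 0 ≤ T) (x : H) : 0 ≤ (⟪x, T x⟫_ℂ).re :=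
  (T.nonneg_iff_isPositive.1 hT).re_inner_nonneg_right x

theorem ofReal_re_inner_apply {T : H →L[ℂ] H} (hT : 0 ≤ T) (x : H) :
    ((⟪x, T x⟫_ℂ).re : ℂ) = ⟪x, T x⟫_ℂ :=
  Complex.conj_eq_iff_re.1 (by
    rw [inner_conj_symm]
    exact (T.nonneg_iff_isPositive.1 hT).isSymmetric x x)

variable [CompleteSpace H]

open scoped ComplexOrder in
theorem le_iff_inner_le {S T : H →L[ℂ] H} :
    S ≤ T ↔ ∀ x, ⟪x, S x⟫_ℂ ≤ ⟪x, T x⟫_ℂ := by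
  rw [← sub_nonneg, ContinuousLinearMap.nonneg_iff_isPositive]
  constructor
  · intro h x
    have := h.inner_nonneg_right x
    rwa [sub_apply, inner_sub_right, sub_nonneg] at this
  · intro h
    refine ContinuousLinearMap.isPositive_iff_complex _ |>.2 fun x => ?_
    have := h x
    rw [← sub_nonneg, ← inner_sub_right, ← sub_apply] at this
    obtain ⟨h1, h2⟩ := Complex.nonneg_iff.1 this
    rw [← inner_conj_symm]
    generalize ⟪x, (T - S) x⟫_ℂ = z at *
    exact ⟨Complex.ext (by simp) (by simp [← h2]), by simpa using h1⟩

/-- A quantitative form of `⟪x, T x⟫ = 0 → T x = 0` for positive `T`. -/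
theorem norm_apply_sq_le {T : H →L[ℂ] H} (hT : 0 ≤ T) (x : H) :
    ‖T x‖ ^ 2 ≤ ‖T‖ * (⟪x, T x⟫_ℂ).re := by
  have hS : IsSelfAdjoint (CFC.sqrt T) := (CFC.sqrt_nonneg T).isSelfAdjoint
  have hSS := CFC.sqrt_mul_sqrt_self T hT
  have e1 : T x = CFC.sqrt T (CFC.sqrt T x) := by
    rw [← mul_apply_eq_comp, hSS]
  have e2 : (⟪x, T x⟫_ℂ).re = ‖CFC.sqrt T x‖ ^ 2 := by
    rw [e1, ← ContinuousLinearMap.adjoint_inner_left, ← ContinuousLinearMap.star_eq_adjoint,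
      hS.star_eq, inner_self_eq_norm_sq_to_K]
    norm_cast
  have e3 : ‖T‖ = ‖CFC.sqrt T‖ ^ 2 := by
    conv_lhs => rw [← hSS]
    rw [hS.norm_mul_self]
  rw [e2, e3, e1, ← mul_pow]
  gcongr
  exact ContinuousLinearMap.le_opNorm _ _

theorem hasSum_wot_iff {ι : Type*} {T : ι → H →L[ℂ] H} {S : H →L[ℂ] H} :
    HasSum (fun i => ContinuousLinearMapWOT.ofCLM (σ := RingHom.id ℂ) (T i))
      (ContinuousLinearMapWOT.ofCLM S) ↔ ∀ x y : H, HasSum (fun i => ⟪x, T i y⟫_ℂ) ⟪x, S y⟫_ℂ := by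
  have key (s : Finset ι) (x y : H) :
      ⟪x, (∑ i ∈ s, ContinuousLinearMapWOT.ofCLM (σ := RingHom.id ℂ) (T i)) y⟫_ℂ =
        ∑ i ∈ s, ⟪x, T i y⟫_ℂ := by
    induction s using Finset.cons_induction with
    | empty => simp
    | cons i s hi ih =>
      rw [Finset.sum_cons, Finset.sum_cons, ← ih, ContinuousLinearMapWOT.add_apply, inner_add_right]
      rfl
  simp only [HasSum, ContinuousLinearMapWOT.tendsto_iff_forall_inner_apply_tendsto, key]
  exact forall_comm

/-- A series of positive operators with bounded partial sums converges in the weak operator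
topology. It converges strongly because of `norm_apply_sq_le`, and the limit is bounded by the
Banach-Steinhaus theorem. -/
theorem summable_wot_of_sum_le {T : ℕ → H →L[ℂ] H} (hT : ∀ n, 0 ≤ T n) {M : H →L[ℂ] H}
    (hM : ∀ N, ∑ n ∈ Finset.range N, T n ≤ M) :
    Summable fun n => ContinuousLinearMapWOT.ofCLM (σ := RingHom.id ℂ) (T n) := by
  have hMs (s : Finset ℕ) : ∑ n ∈ s, T n ≤ M := by
    obtain ⟨N, hN⟩ := s.exists_nat_subset_range
    exact (Finset.sum_le_sum_of_subset_of_nonneg hN fun n _ _ => hT n).trans (hM N)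
  have hre (s : Finset ℕ) (x : H) :
      (⟪x, (∑ n ∈ s, T n) x⟫_ℂ).re = ∑ n ∈ s, (⟪x, T n x⟫_ℂ).re := by
    rw [sum_apply, inner_sum, Complex.re_sum]
  have hq (x : H) : Summable fun n => (⟪x, T n x⟫_ℂ).re := by
    refine summable_of_sum_le (c := (⟪x, M x⟫_ℂ).re) (fun n => re_inner_apply_nonneg (hT n) x)
      fun s => ?_
    have := re_inner_apply_nonneg (sub_nonneg.2 (hMs s)) x
    rw [sub_apply, inner_sub_right, Complex.sub_re, hre] at this
    linarith
  have hsum (x : H) : Summable fun n => T n x := by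
    rw [summable_iff_vanishing_norm]
    intro ε hε
    -- adding `1` keeps the denominator positive when `M = 0`
    have hδ : 0 < ε ^ 2 / (‖M‖ + 1) := by positivity
    obtain ⟨s, hs⟩ := summable_iff_vanishing_norm.1 (hq x) _ hδ
    refine ⟨s, fun t ht => ?_⟩
    have h0 : 0 ≤ ∑ n ∈ t, T n := Finset.sum_nonneg fun n _ => hT n
    have h1 := norm_apply_sq_le h0 x
    have h2 : ‖∑ n ∈ t, T n‖ ≤ ‖M‖ := CStarAlgebra.norm_le_norm_of_nonneg_of_le h0 (hMs t)
    have h3 := (le_abs_self _).trans_lt (hs t ht)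
    have h4 := re_inner_apply_nonneg h0 x
    rw [lt_div_iff₀ (by positivity)] at h3
    rw [hre] at h1 h4
    rw [sum_apply] at h1
    refine lt_of_pow_lt_pow_left₀ 2 hε.le ?_
    nlinarith [norm_nonneg M]
  have hlim : Filter.Tendsto (fun (s : Finset ℕ) x => (∑ n ∈ s, T n) x) Filter.atTop
      (nhds fun x => ∑' n, T n x) := by
    rw [tendsto_pi_nhds]
    intro x
    simpa only [sum_apply, HasSum, SummationFilter.unconditional_filter] using (hsum x).hasSum
  refine ⟨ContinuousLinearMapWOT.ofCLM (continuousLinearMapOfTendsto _ hlim),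
    hasSum_wot_iff.2 fun x y => ?_⟩
  exact (hsum y).hasSum.mapL (innerSL ℂ x)

/-! ### Monotonicity of the trace -/

theorem isTraceClass_of_le_smul {S T : H →L[ℂ] H} (hS : 0 ≤ S) (hT : 0 ≤ T) {r : ℝ}
    (hST : S ≤ r • T) (h : IsTraceClass T) :
    IsTraceClass S ∧ (trace S).re ≤ r * (trace T).re := by
  have hle (x : H) : (⟪x, S x⟫_ℂ).re ≤ r * (⟪x, T x⟫_ℂ).re := by
    have := re_inner_apply_nonneg (sub_nonneg.2 hST) x
    rw [sub_apply, smul_apply, inner_sub_right,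
      Complex.sub_re, inner_smul_right_eq_smul, Complex.smul_re, smul_eq_mul] at this
    linarith
  have hsT {ι : Type u} (b : HilbertBasis ι ℂ H) : Summable fun i => (⟪b i, T (b i)⟫_ℂ).re := by
    have := h ι b
    rw [CFC.abs_of_nonneg T hT] at this
    exact Complex.reCLM.summable this
  have hsS {ι : Type u} (b : HilbertBasis ι ℂ H) : Summable fun i => (⟪b i, S (b i)⟫_ℂ).re :=
    .of_nonneg_of_le (fun i => re_inner_apply_nonneg hS _) (fun i => hle _) ((hsT b).mul_left r)
  refine ⟨fun ι b => ?_, ?_⟩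
  · rw [CFC.abs_of_nonneg S hS]
    exact (Complex.ofRealCLM.summable (hsS b)).congr fun i => ofReal_re_inner_apply hS (b i)
  · have hre {X : H →L[ℂ] H} (hX : 0 ≤ X) {ι : Type u} (b : HilbertBasis ι ℂ H) :
        (∑' i, ⟪b i, X (b i)⟫_ℂ).re = ∑' i, (⟪b i, X (b i)⟫_ℂ).re := by
      rw [← Complex.ofReal_re (∑' i, _), Complex.ofReal_tsum,
        tsum_congr fun i => ofReal_re_inner_apply hX (b i)]
    unfold trace
    rw [hre hS, hre hT, ← tsum_mul_left]
    exact (hsS _).tsum_le_tsum (fun i => hle _) ((hsT _).mul_left r)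

/-! ### The sum of powers as a least upper bound -/

open scoped ComplexOrder in
theorem sumPow_isLUB {p : ℝ} {a : ℕ → H →L[ℂ] H} (h : SummablePow p a) :
    IsLUB (Set.range fun N => ∑ n ∈ Finset.range N, a n ^ p) (sumPow p a) := by
  have hs (x : H) : HasSum (fun n => ⟪x, (a n ^ p) x⟫_ℂ) ⟪x, sumPow p a x⟫_ℂ :=
    hasSum_wot_iff.1 h.hasSum x x
  have hsum (N : ℕ) (x : H) : ⟪x, (∑ n ∈ Finset.range N, a n ^ p) x⟫_ℂ =
      ∑ n ∈ Finset.range N, ⟪x, (a n ^ p) x⟫_ℂ := by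
    rw [sum_apply, inner_sum]
  constructor
  · rintro _ ⟨N, rfl⟩
    refine le_iff_inner_le.2 fun x => ?_
    rw [hsum]
    refine sum_le_hasSum _ (fun n _ => ?_) (hs x)
    exact ((a n ^ p).nonneg_iff_isPositive.1 CFC.rpow_nonneg).inner_nonneg_right x
  · intro M hM
    refine le_iff_inner_le.2 fun x => le_of_tendsto' (hs x).tendsto_sum_nat fun N => ?_
    rw [← hsum]
    exact le_iff_inner_le.1 (hM ⟨N, rfl⟩) x

theorem sumPow_nonneg {p : ℝ} {a : ℕ → H →L[ℂ] H} (h : SummablePow p a) : 0 ≤ sumPow p a :=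
  (sumPow_isLUB h).1 ⟨0, by simp⟩

theorem sum_le_sumPow {p : ℝ} {a : ℕ → H →L[ℂ] H} (h : SummablePow p a) (N : ℕ) :
    ∑ n ∈ Finset.range N, a n ^ p ≤ sumPow p a :=
  (sumPow_isLUB h).1 ⟨N, rfl⟩

/-! ### Hardy's inequality for the sum of powers and its trace -/

theorem hardy_nonneg {a : ℕ → H →L[ℂ] H} (ha : ∀ n, 0 ≤ a n) (n : ℕ) : 0 ≤ hardy a n :=
  smul_nonneg (by positivity) (Finset.sum_nonneg fun k _ => ha k)

/-- Hardy's inequality for infinite sums, in the Loewner order. -/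
theorem summablePow_hardy {p : ℝ} (hp : 1 < p) (hp2 : p ≤ 2) {a : ℕ → H →L[ℂ] H}
    (ha : ∀ n, 0 ≤ a n) (h : SummablePow p a) :
    SummablePow p (hardy a) ∧ sumPow p (hardy a) ≤ (p / (p - 1)) ^ p • sumPow p a := by
  have hC : 0 ≤ (p / (p - 1)) ^ p :=
    Real.rpow_nonneg (div_nonneg (by linarith) (by linarith)) p
  have hM (N : ℕ) : ∑ n ∈ Finset.range N, hardy a n ^ p ≤ (p / (p - 1)) ^ p • sumPow p a :=
    (sum_hardy_rpow_le hp hp2 ha N).trans (smul_le_smul_of_nonneg_left (sum_le_sumPow h N) hC)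
  have hs : SummablePow p (hardy a) := summable_wot_of_sum_le (fun n => CFC.rpow_nonneg) hM
  refine ⟨hs, (sumPow_isLUB hs).2 ?_⟩
  rintro _ ⟨N, rfl⟩
  exact hM N

end

end OperatorHardy

theorem mainTheorem5 {H : Type*} [NormedAddCommGroup H] [InnerProductSpace ℂ H] [CompleteSpace H]
    (p : ℝ) (hp : 1 < p) (hp2 : p ≤ 2) (a : ℕ → H →L[ℂ] H) (ha : OperatorHardy.InDomain p a) :
    OperatorHardy.InDomain p (OperatorHardy.hardy a) ∧
      OperatorHardy.Phi p (OperatorHardy.hardy a) ≤ p / (p - 1) * OperatorHardy.Phi p a := by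
  obtain ⟨hs, hle⟩ := OperatorHardy.summablePow_hardy hp hp2 ha.nonneg ha.summable
  have hp0 : 0 < p := by linarith
  have hC : 0 ≤ p / (p - 1) := div_nonneg hp0.le (by linarith)
  have hroot : OperatorHardy.sumPow p (OperatorHardy.hardy a) ^ (1 / p) ≤
      (p / (p - 1)) • OperatorHardy.sumPow p a ^ (1 / p) := by
    have h1p : 1 / p ≤ 1 := by rw [div_le_one hp0]; exact hp.le
    refine (CFC.monotone_rpow ⟨by positivity, h1p⟩ hle).trans_eq ?_
    beta_reduce
    rw [CFC.smul_rpow (by positivity) (Real.rpow_nonneg hC p)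
      (OperatorHardy.sumPow_nonneg ha.summable), ← Real.rpow_mul hC, mul_one_div_cancel hp0.ne',
      Real.rpow_one]
  obtain ⟨htc, htr⟩ := OperatorHardy.isTraceClass_of_le_smul
    (S := OperatorHardy.sumPow p (OperatorHardy.hardy a) ^ (1 / p))
    (T := OperatorHardy.sumPow p a ^ (1 / p)) CFC.rpow_nonneg CFC.rpow_nonneg
    hroot ha.traceClass
  refine ⟨⟨OperatorHardy.hardy_nonneg ha.nonneg, hs, htc⟩, ?_⟩
  unfold OperatorHardy.Phi
  exact htr
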